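/- **Setting.** Let $q\in H^2(\mathbb R)\cap H^{1,1}(\mathbb R)$ be complex valued, where $L^{2,s}=\{f\in L^2:\langle x\rangle^s f\in L^2\}$, $\langle x\rangle=\sqrt{1+|x|^2}$, $H^{k,s}=\{f:\partial_x^jf\in L^{2,s},\ 0\le j\le k\}$ and $H^k=H^{k,0}$. Put $D_\pm=\{\lambda\in\mathbb C:\pm\operatorname{Im}\lambda^2>0\}$, $$\sigma_3=\begin{pmatrix}1&0\\0&-1\end{pmatrix},\quad Q=\begin{pmatrix}0&q\\-\bar q&0\end{pmatrix},\quad \tilde U=\tfrac i4|q|^2\sigma_3+\lambda Q .$$ Let $\varphi_\pm(x;\lambda)$ and $\phi_\pm(x;\lambda)$ be the Jost functions of $q$, that is, the first and second columns of $\psi_\pm$, each being the bounded continuous solution of the corresponding column of the Volterra equation $$\psi_-(x)=I+\int_{-\infty}^x e^{-i\lambda^2(x-y)\sigma_3}\,\tilde U(y)\psi_-(y)\,e^{i\lambda^2(x-y)\sigma_3}\,dy,\qquad \psi_+(x)=I-\int_x^{\infty} e^{-i\lambda^2(x-y)\sigma_3}\,\tilde U(y)\psi_+(y)\,e^{i\lambda^2(x-y)\sigma_3}\,dy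 ,$$ where $\varphi_-,\phi_+$ are taken for $\lambda\in D_+$ and $\varphi_+,\phi_-$ for $\lambda\in D_-$. For $\mu\in\mathbb C$ and $\Phi=(f,g)^T\in\mathbb C^2$ put $m_\mu(\Phi)=\mu|f|^2+\bar\mu|g|^2$, $C=m_{\bar\mu}(\Phi)/m_\mu(\Phi)$, $D=(\mu^2-\bar\mu^2)f\bar g/m_\mu(\Phi)$, and let the modified Darboux matrix be $$T(\Phi,\lambda,\mu)=\frac{\mu^{1/2}}{\bar\mu^{1/2}\lambda^2-\mu^2\bar\mu^{1/2}}\begin{pmatrix}C^{1/2}\lambda^2-|\mu|^2\bar C^{1/2}&-D\,\bar C^{1/2}\lambda\\ \bar D\,C^{1/2}\lambda&\bar C^{1/2}\lambda^2-|\mu|^2C^{1/2}\end{pmatrix}$$ with principal square roots. Let $\lambda_1$ satisfy $\operatorname{Re}\lambda_1>0$ and $\operatorname{Im}\lambda_1>0$, and define the new Jost functions $$\varphi_-^{(1)}(x;\lambda)=T\big(\varphi_-(x;\lambda_1)e^{-i\lambda_1^2x},\lambda,\lambda_1\big)\varphi_-(x;\lambda),\qquad \varphi_+^{(1)}(x;\lambda)=T\big(\varphi_+(x;\bar\lambda_1)e^{-i\bar\lambda_1^2x},\lambda,\bar\lambda_1\big)\varphi_+(x;\lambda),$$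 $$\phi_+^{(1)}(x;\lambda)=T\big(\phi_+(x;\lambda_1)e^{i\lambda_1^2x},\lambda,\lambda_1\big)\phi_+(x;\lambda),\qquad \phi_-^{(1)}(x;\lambda)=T\big(\phi_-(x;\bar\lambda_1)e^{i\bar\lambda_1^2x},\lambda,\bar\lambda_1\big)\phi_-(x;\lambda).$$ **Proposition 4.1.** The Jost functions $\varphi_-,\phi_+$ (for $\lambda\in D_+$) and $\varphi_+,\phi_-$ (for $\lambda\in D_-$) exist and are unique. For every $x\in\mathbb R$, the functions $\lambda\mapsto\varphi_-^{(1)}(x;\lambda)$ and $\lambda\mapsto\phi_+^{(1)}(x;\lambda)$ are holomorphic on $D_+\setminus\{\lambda_1,-\lambda_1\}$, and the points $\pm\lambda_1\in D_+$ are removable singularities, i.e. each function extends to a holomorphic function on $D_+$. Likewise $\lambda\mapsto\varphi_+^{(1)}(x;\lambda)$ and $\lambda\mapsto\phi_-^{(1)}(x;\lambda)$ are holomorphic on $D_-\setminus\{\bar\lambda_1,-\bar\lambda_1\}$, and the points $\pm\bar\lambda_1\in D_-$ are removable singularities, i.e. each function extends to a holomorphic function on $D_-$. -/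

import Mathlib

open scoped ContDiff ComplexConjugate

noncomputable section

namespace DNLSII

/-! Weighted Sobolev spaces on the line, through weak derivatives. -/

/-- `g` is the weak derivative of `f` on the real line. -/
def HasWeakDeriv (f g : ℝ → ℂ) : Prop :=
  MeasureTheory.LocallyIntegrable f ∧ MeasureTheory.LocallyIntegrable g ∧
    ∀ η : ℝ → ℂ, ContDiff ℝ ∞ η → HasCompactSupport η →
      ∫ x, deriv η x * f x = -∫ x, η x * g x

/-- The weight `⟨x⟩ = √(1 + |x|²)`. -/
def bracket (x : ℝ) : ℝ := Real.sqrt (1 + |x| ^ 2)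

/-- Membership in `L^{2,s}`: both `f` and `⟨x⟩^s f` are square integrable. -/
def MemWeightedL2 (s : ℝ) (f : ℝ → ℂ) : Prop :=
  MeasureTheory.MemLp f 2 ∧
    MeasureTheory.MemLp (fun x => ((bracket x ^ s : ℝ) : ℂ) * f x) 2

/-- Membership in `H^{k,s}`: the weak derivatives `g 0 = f, g 1, …, g k` lie in `L^{2,s}`. -/
def MemWeightedSobolev (k : ℕ) (s : ℝ) (f : ℝ → ℂ) : Prop :=
  ∃ g : ℕ → ℝ → ℂ, g 0 = f ∧ (∀ j < k, HasWeakDeriv (g j) (g (j + 1))) ∧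
    ∀ j ≤ k, MemWeightedL2 s (g j)

/-- Membership in `H^k = H^{k,0}`. -/
def MemSobolev (k : ℕ) (f : ℝ → ℂ) : Prop := MemWeightedSobolev k 0 f

/-! Regions of the spectral plane. -/

/-- The open first quadrant `C_I`. -/
def firstQuadrant : Set ℂ := {z | 0 < z.re ∧ 0 < z.im}

/-- `D₊`: the open first and third quadrants. -/
def Dplus : Set ℂ := {z | 0 < (z ^ 2).im}

/-- `D₋`: the open second and fourth quadrants. -/
def Dminus : Set ℂ := {z | (z ^ 2).im < 0}

/-! The Lax pair in the normalisation `ψ = ϕ exp(i z² x σ₃)`, with `r = conj q`. -/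

/-- The Pauli matrix `σ₃`. -/
def sigma3 : Matrix (Fin 2) (Fin 2) ℂ := !![1, 0; 0, -1]

/-- The off-diagonal potential `Q` for `r = conj q`. -/
def potentialQ (q : ℝ → ℂ) (x : ℝ) : Matrix (Fin 2) (Fin 2) ℂ := !![0, q x; -conj (q x), 0]

/-- `Ũ = (i/4) q r σ₃ + z Q` with `r = conj q`. -/
def Utilde (q : ℝ → ℂ) (z : ℂ) (x : ℝ) : Matrix (Fin 2) (Fin 2) ℂ :=
  (Complex.I / 4 * (q x * conj (q x))) • sigma3 + z • potentialQ q x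

/-- The action of `A ↦ exp(-i z² s σ₃) A exp(i z² s σ₃)` on the `j`-th column of `A`. -/
def columnPropagator (z : ℂ) (j : Fin 2) (s : ℝ) : Matrix (Fin 2) (Fin 2) ℂ :=
  Matrix.diagonal fun i => Complex.exp (-Complex.I * z ^ 2 * s * (sigma3 i i - sigma3 j j))

/-- `u` is a bounded continuous solution of the `j`-th column of the Volterra equation
`ψ₋(x) = I + ∫_{-∞}^x exp(-i z² (x-y) σ₃) Ũ(y) ψ₋(y) exp(i z² (x-y) σ₃) dy`. -/
def IsJostMinus (q : ℝ → ℂ) (z : ℂ) (j : Fin 2) (u : ℝ → Fin 2 → ℂ) : Prop :=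
  Continuous u ∧ (∃ M : ℝ, ∀ x, ‖u x‖ ≤ M) ∧
    ∀ x, u x = Pi.single j 1 +
      ∫ y in Set.Iic x, Matrix.mulVec (columnPropagator z j (x - y) * Utilde q z y) (u y)

/-- `u` is a bounded continuous solution of the `j`-th column of the Volterra equation
`ψ₊(x) = I - ∫_x^∞ exp(-i z² (x-y) σ₃) Ũ(y) ψ₊(y) exp(i z² (x-y) σ₃) dy`. -/
def IsJostPlus (q : ℝ → ℂ) (z : ℂ) (j : Fin 2) (u : ℝ → Fin 2 → ℂ) : Prop :=
  Continuous u ∧ (∃ M : ℝ, ∀ x, ‖u x‖ ≤ M) ∧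
    ∀ x, u x = Pi.single j 1 -
      ∫ y in Set.Ioi x, Matrix.mulVec (columnPropagator z j (x - y) * Utilde q z y) (u y)

/-- The Jost function `φ₋(x; z)` (first column of `ψ₋`), meaningful for `z ∈ D₊`. -/
def varphiMinus (q : ℝ → ℂ) (x : ℝ) (z : ℂ) : Fin 2 → ℂ :=
  Classical.epsilon (IsJostMinus q z 0) x

/-- The Jost function `φ₊(x; z)` (first column of `ψ₊`), meaningful for `z ∈ D₋`. -/
def varphiPlus (q : ℝ → ℂ) (x : ℝ) (z : ℂ) : Fin 2 → ℂ :=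
  Classical.epsilon (IsJostPlus q z 0) x

/-- The Jost function `ϕ₋(x; z)` (second column of `ψ₋`), meaningful for `z ∈ D₋`. -/
def phiMinus (q : ℝ → ℂ) (x : ℝ) (z : ℂ) : Fin 2 → ℂ :=
  Classical.epsilon (IsJostMinus q z 1) x

/-- The Jost function `ϕ₊(x; z)` (second column of `ψ₊`), meaningful for `z ∈ D₊`. -/
def phiPlus (q : ℝ → ℂ) (x : ℝ) (z : ℂ) : Fin 2 → ℂ :=
  Classical.epsilon (IsJostPlus q z 1) x

/-! The modified two-fold Darboux matrix. -/

/-- The form `m_w(f, g) = w f₁ conj g₁ + conj w f₂ conj g₂`. -/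
def formM (w : ℂ) (f g : Fin 2 → ℂ) : ℂ := w * f 0 * conj (g 0) + conj w * f 1 * conj (g 1)

/-- `C_w(Φ) = m_{conj w}(Φ, Φ) / m_w(Φ, Φ)`. -/
def coeffC (w : ℂ) (Φ : Fin 2 → ℂ) : ℂ := formM (conj w) Φ Φ / formM w Φ Φ

/-- `D_w(Φ) = (w² - conj w²) f conj g / m_w(Φ, Φ)` for `Φ = (f, g)`. -/
def coeffD (w : ℂ) (Φ : Fin 2 → ℂ) : ℂ :=
  (w ^ 2 - conj w ^ 2) * Φ 0 * conj (Φ 1) / formM w Φ Φ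

/-- The modified Darboux matrix `T(Φ, z, w)`; all square roots are principal. -/
def darboux (Φ : Fin 2 → ℂ) (z w : ℂ) : Matrix (Fin 2) (Fin 2) ℂ :=
  (w ^ (1 / 2 : ℂ) / (conj w ^ (1 / 2 : ℂ) * z ^ 2 - w ^ 2 * conj w ^ (1 / 2 : ℂ))) •
    !![coeffC w Φ ^ (1 / 2 : ℂ) * z ^ 2 - (‖w‖ : ℂ) ^ 2 * conj (coeffC w Φ) ^ (1 / 2 : ℂ),
       -(coeffD w Φ * conj (coeffC w Φ) ^ (1 / 2 : ℂ) * z);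
       conj (coeffD w Φ) * coeffC w Φ ^ (1 / 2 : ℂ) * z,
       conj (coeffC w Φ) ^ (1 / 2 : ℂ) * z ^ 2 - (‖w‖ : ℂ) ^ 2 * coeffC w Φ ^ (1 / 2 : ℂ)]

/-! The new Jost functions. -/

/-- `φ₋⁽¹⁾(x; z) = T(φ₋(x; w) exp(-i w² x), z, w) φ₋(x; z)`. -/
def newVarphiMinus (q : ℝ → ℂ) (w : ℂ) (x : ℝ) (z : ℂ) : Fin 2 → ℂ :=
  Matrix.mulVec (darboux (Complex.exp (-Complex.I * w ^ 2 * x) • varphiMinus q x w) z w)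
    (varphiMinus q x z)

/-- `φ₊⁽¹⁾(x; z) = T(φ₊(x; w̄) exp(-i w̄² x), z, w̄) φ₊(x; z)`. -/
def newVarphiPlus (q : ℝ → ℂ) (w : ℂ) (x : ℝ) (z : ℂ) : Fin 2 → ℂ :=
  Matrix.mulVec
    (darboux (Complex.exp (-Complex.I * conj w ^ 2 * x) • varphiPlus q x (conj w)) z (conj w))
    (varphiPlus q x z)

/-- `ϕ₊⁽¹⁾(x; z) = T(ϕ₊(x; w) exp(i w² x), z, w) ϕ₊(x; z)`. -/
def newPhiPlus (q : ℝ → ℂ) (w : ℂ) (x : ℝ) (z : ℂ) : Fin 2 → ℂ :=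
  Matrix.mulVec (darboux (Complex.exp (Complex.I * w ^ 2 * x) • phiPlus q x w) z w)
    (phiPlus q x z)

/-- `ϕ₋⁽¹⁾(x; z) = T(ϕ₋(x; w̄) exp(i w̄² x), z, w̄) ϕ₋(x; z)`. -/
def newPhiMinus (q : ℝ → ℂ) (w : ℂ) (x : ℝ) (z : ℂ) : Fin 2 → ℂ :=
  Matrix.mulVec
    (darboux (Complex.exp (Complex.I * conj w ^ 2 * x) • phiMinus q x (conj w)) z (conj w))
    (phiMinus q x z)

/-- `f` is holomorphic on `U` except for the points of `S`, which lie in `U`, and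
every one of these is a removable singularity. -/
def HasOnlyRemovableSingularities (f : ℂ → Fin 2 → ℂ) (U S : Set ℂ) : Prop :=
  S ⊆ U ∧ DifferentiableOn ℂ f (U \ S) ∧
    ∃ F : ℂ → Fin 2 → ℂ, DifferentiableOn ℂ F U ∧ Set.EqOn F f (U \ S)

end DNLSII

end

/-! At fixed `x` the only possible poles of a new Jost function come from the scalar factor `(z² -
w²)⁻¹` of the Darboux matrix; the remaining factor is polynomial in `z`. It therefore suffices that
the numerator, applied to the Jost function `u`, is holomorphic and vanishes at both `w` and `-w`.

Vanishing at `w` is algebra: the numerator annihilates its seed, which is a nonzero multiple of `u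
w` (`darbouxNumerator_mulVec_self`). Here `0 < re w` keeps `m_w` away from zero and the principal
square roots off their cut. Vanishing at `-w` follows by symmetry: conjugation by `σ₃` realises `z ↦
-z` both in the numerator and in the Volterra equation, so by uniqueness `u (-w) = ± σ₃ u w`
(`jostSolution_neg`).

Existence, uniqueness and holomorphy of `u` come from Picard iteration. The potential is in `L¹ ∩
L²`, so the kernel is dominated by an integrable function, locally uniformly in `z`. An exponential
weight makes the Volterra operator a contraction with factor `1/2`, and uniform limits of
holomorphic iterates are holomorphic. -/

noncomputable section

namespace DNLSII

open MeasureTheory Filter Set Topology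

/-! ### Contracting weights for Volterra operators -/

/-- A nonnegative-exponent weight that turns the Volterra operator with an integrable bound into a
contraction. -/
theorem exists_weight_Iic {m : ℝ → ℝ} (hm : Integrable m) :
    ∃ (w : ℝ → ℝ) (W : ℝ), Continuous w ∧ (∀ x, 1 ≤ w x) ∧ (∀ x, w x ≤ W) ∧
      ∀ x, ∫ y in Iic x, m y * w y ≤ 1 / 2 * w x := by
  -- A continuous approximant makes the primitive `H` differentiable everywhere. The error `1/4` in
  -- `L¹` and the rate `4` in the exponent each contribute `1/4` to the final factor `1/2`.
  obtain ⟨g, -, hg, hgc, hgi⟩ := hm.exists_hasCompactSupport_integral_sub_le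
    (show (0 : ℝ) < 1 / 4 by norm_num)
  set h : ℝ → ℝ := fun y => ‖g y‖ with hh
  have hhc : Continuous h := hgc.norm
  have hhi : Integrable h := hgi.norm
  have hh0 : ∀ y, 0 ≤ h y := fun y => norm_nonneg _
  set A : ℝ := ∫ y, h y
  set H : ℝ → ℝ := fun x => ∫ y in (0 : ℝ)..x, h y with hH
  have hHd : ∀ x, HasDerivAt H (h x) x := fun x =>
    intervalIntegral.integral_hasDerivAt_right (hhc.intervalIntegrable _ _)
      hhc.stronglyMeasurable.stronglyMeasurableAtFilter hhc.continuousAt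
  have hHabs : ∀ x, |H x| ≤ A := fun x => by
    have := intervalIntegral.norm_integral_le_integral_norm_uIoc (f := h) (a := 0) (b := x)
      (μ := volume)
    refine this.trans ?_
    simp only [hh, norm_norm]
    exact setIntegral_le_integral hhi (Eventually.of_forall hh0)
  set w : ℝ → ℝ := fun x => Real.exp (4 * (H x + A)) with hw
  have hHc : Continuous H := continuous_iff_continuousAt.2 fun x => (hHd x).continuousAt
  have hwc : Continuous w := by fun_prop
  have hwpos : ∀ x, 0 < w x := fun x => Real.exp_pos _
  have hHmono : Monotone H := monotone_of_deriv_nonneg (fun x => (hHd x).differentiableAt)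
    fun x => by rw [(hHd x).deriv]; exact hh0 x
  have hwmono : Monotone w := fun x y hxy => by
    simp only [hw]
    gcongr
    exact hHmono hxy
  have hwd : ∀ x, HasDerivAt w (4 * (h x * w x)) x := fun x => by
    have := (((hHd x).add_const A).const_mul 4).exp
    convert! this using 1
    simp only [hw]; ring
  have hwW : ∀ x, w x ≤ Real.exp (8 * A) := fun x => by
    apply Real.exp_le_exp.2
    linarith [(abs_le.1 (hHabs x)).2]
  have hhw : Integrable fun y => h y * w y :=
    hhi.mul_bdd (c := Real.exp (8 * A)) hwc.aestronglyMeasurable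
      (Eventually.of_forall fun y => by rw [Real.norm_of_nonneg (hwpos y).le]; exact hwW y)
  have hmw : Integrable fun y => m y * w y :=
    hm.mul_bdd (c := Real.exp (8 * A)) hwc.aestronglyMeasurable
      (Eventually.of_forall fun y => by rw [Real.norm_of_nonneg (hwpos y).le]; exact hwW y)
  refine ⟨w, Real.exp (8 * A), hwc, fun x => ?_, hwW, fun x => ?_⟩
  · apply Real.one_le_exp
    linarith [(abs_le.1 (hHabs x)).1]
  · have hlim : Tendsto H atBot (𝓝 (-∫ y in Iic 0, h y)) := by
      have := (intervalIntegral_tendsto_integral_Iic (f := h) 0 hhi.integrableOn tendsto_id).neg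
      refine this.congr fun t => ?_
      simp only [hH, id]
      rw [intervalIntegral.integral_symm]; simp
    have hwlim : Tendsto w atBot (𝓝 (Real.exp (4 * (-(∫ y in Iic 0, h y) + A)))) :=
      (Real.continuous_exp.tendsto _).comp ((hlim.add_const A).const_mul 4)
    have h1 := integral_Iic_of_hasDerivAt_of_tendsto' (a := x) (fun y _ => hwd y)
      ((hhw.const_mul 4).integrableOn) hwlim
    -- Since `w' = 4 h w`, the integral of `4 h w` up to `x` is `w x` minus a positive limit at
    -- `-∞`.
    have h2 : ∫ y in Iic x, h y * w y ≤ 1 / 4 * w x := by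
      rw [integral_const_mul] at h1
      have := Real.exp_pos (4 * (-(∫ y in Iic 0, h y) + A))
      linarith
    have h3 : ∫ y in Iic x, ‖m y - g y‖ * w x ≤ 1 / 4 * w x := by
      rw [integral_mul_const]
      refine mul_le_mul_of_nonneg_right ?_ (hwpos x).le
      exact (setIntegral_le_integral (hm.sub hgi).norm
        (Eventually.of_forall fun _ => norm_nonneg _)).trans hg
    have hi3 : Integrable fun y => ‖m y - g y‖ * w x := (hm.sub hgi).norm.mul_const _
    calc ∫ y in Iic x, m y * w y
        ≤ ∫ y in Iic x, (h y * w y + ‖m y - g y‖ * w x) := by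
          refine setIntegral_mono_on hmw.integrableOn (hhw.add hi3).integrableOn
            measurableSet_Iic fun y hy => ?_
          have e1 : m y ≤ h y + ‖m y - g y‖ := by
            have h5 : m y - g y ≤ ‖m y - g y‖ := le_abs_self _
            have h6 : g y ≤ h y := le_abs_self _
            linarith
          have e2 : w y ≤ w x := hwmono hy
          calc m y * w y ≤ (h y + ‖m y - g y‖) * w y :=
                mul_le_mul_of_nonneg_right e1 (hwpos y).le
            _ ≤ _ := by
                rw [add_mul]
                gcongr
      _ = (∫ y in Iic x, h y * w y) + ∫ y in Iic x, ‖m y - g y‖ * w x :=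
          integral_add hhw.integrableOn hi3.integrableOn
      _ ≤ _ := by linarith

theorem exists_weight_Ioi {m : ℝ → ℝ} (hm : Integrable m) :
    ∃ (w : ℝ → ℝ) (W : ℝ), Continuous w ∧ (∀ x, 1 ≤ w x) ∧ (∀ x, w x ≤ W) ∧
      ∀ x, ∫ y in Ioi x, m y * w y ≤ 1 / 2 * w x := by
  obtain ⟨w, W, hc, h1, hW, h⟩ := exists_weight_Iic (m := fun y => m (-y)) hm.comp_neg
  refine ⟨fun x => w (-x), W, hc.comp continuous_neg, fun x => h1 _, fun x => hW _, fun x => ?_⟩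
  have := integral_comp_neg_Iic (-x) fun y => m y * w (-y)
  rw [neg_neg] at this
  rw [← this]
  simpa using h (-x)

/-! ### Holomorphy under the integral sign -/

/-- A dominated integral of holomorphic functions is holomorphic. -/
theorem differentiableOn_integral_of_dominated {α E : Type*} [MeasurableSpace α]
    {μ : Measure α} [NormedAddCommGroup E] [NormedSpace ℂ E] [CompleteSpace E]
    {U : Set ℂ} (hU : IsOpen U) {F : ℂ → α → E} {b : α → ℝ}
    (hmeas : ∀ z ∈ U, AEStronglyMeasurable (F z) μ) (hb : Integrable b μ)
    (hbound : ∀ z ∈ U, ∀ a, ‖F z a‖ ≤ b a)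
    (hdiff : ∀ a, DifferentiableOn ℂ (fun z => F z a) U) :
    DifferentiableOn ℂ (fun z => ∫ a, F z a ∂μ) U := by
  intro z hz
  obtain ⟨r, hr, hrU⟩ := Metric.isOpen_iff.1 hU z hz
  have hr2 : 0 < r / 2 := by linarith
  have hsub : ∀ y ∈ Metric.ball z (r / 2), Metric.closedBall y (r / 4) ⊆ U := fun y hy t ht =>
    hrU (by
      rw [Metric.mem_ball] at hy ⊢
      rw [Metric.mem_closedBall] at ht
      linarith [dist_triangle t y z])
  have hder : ∀ a, ∀ y ∈ Metric.ball z (r / 2),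
      HasDerivAt (fun z => F z a) (deriv (fun z => F z a) y) y := fun a y hy =>
    ((hdiff a).differentiableAt (hU.mem_nhds (hsub y hy
      (Metric.mem_closedBall_self (by linarith))))).hasDerivAt
  -- The derivative is measurable in the parameter as a pointwise limit of difference quotients with
  -- steps shorter than `r`.
  have hmeas' : AEStronglyMeasurable (fun a => deriv (fun z => F z a) z) μ := by
    have hlim : ∀ a, Tendsto (fun n : ℕ => ((r / 2 / (n + 2) : ℝ) : ℂ)⁻¹ •
        (F (z + ((r / 2 / (n + 2) : ℝ) : ℂ)) a - F z a)) atTop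
        (𝓝 (deriv (fun z => F z a) z)) := fun a => by
      have h := (hder a z (Metric.mem_ball_self hr2)).tendsto_slope_zero
      refine h.comp (tendsto_nhdsWithin_iff.2 ⟨?_, Eventually.of_forall fun n => ?_⟩)
      · rw [← Complex.ofReal_zero]
        refine (Complex.continuous_ofReal.tendsto _).comp ?_
        refine tendsto_const_nhds.div_atTop ?_
        exact tendsto_atTop_add_const_right _ _ tendsto_natCast_atTop_atTop
      · simp only [mem_compl_iff, mem_singleton_iff, Complex.ofReal_eq_zero]
        positivity
    refine aestronglyMeasurable_of_tendsto_ae atTop (fun n => ?_) (Eventually.of_forall hlim)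
    refine ((hmeas _ (hrU ?_)).sub (hmeas z hz)).const_smul _
    rw [Metric.mem_ball, dist_eq_norm, add_sub_cancel_left, Complex.norm_real,
      Real.norm_of_nonneg (by positivity), div_lt_iff₀ (by positivity)]
    have : (0 : ℝ) ≤ n := n.cast_nonneg
    nlinarith
  refine (hasDerivAt_integral_of_dominated_loc_of_deriv_le (bound := fun a => b a / (r / 4))
    (F' := fun y a => deriv (fun z => F z a) y)
    (Metric.ball_mem_nhds z hr2) ?_ ?_ hmeas' ?_ ?_ ?_).2.differentiableAt.differentiableWithinAt
  · filter_upwards [hU.mem_nhds hz] with y hy using hmeas y hy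
  · exact hb.mono' (hmeas z hz) (Eventually.of_forall (hbound z hz))
  -- Cauchy's estimate on spheres of radius `r / 4` turns the bound on `F` into a bound on its
  -- derivative.
  · refine Eventually.of_forall fun a y hy => ?_
    refine Complex.norm_deriv_le_of_forall_mem_sphere_norm_le (by linarith) ?_ fun t ht =>
      hbound t (hsub y hy (Metric.sphere_subset_closedBall ht)) a
    exact ((hdiff a).mono (hsub y hy)).diffContOnCl_ball subset_rfl
  · exact hb.div_const _
  · exact Eventually.of_forall fun a y hy => hder a y hy

/-! ### Picard iteration for abstract Volterra kernels -/

/-- A family of Volterra type kernels depending holomorphically on `z ∈ U`, dominated by an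
integrable function `m` and contracting with respect to a weight `w`. -/
structure IsContractingKernel (U : Set ℂ) (k : ℂ → ℝ → ℝ → Matrix (Fin 2) (Fin 2) ℂ)
    (b : ℝ → ℝ → ℝ) (m w : ℝ → ℝ) (W : ℝ) : Prop where
  meas : ∀ z ∈ U, ∀ x i j, AEStronglyMeasurable (fun y => k z x y i j)
  bound : ∀ z ∈ U, ∀ x y v, ‖(k z x y).mulVec v‖ ≤ b x y * ‖v‖
  b_meas : ∀ x, AEStronglyMeasurable (b x)
  b_nonneg : ∀ x y, 0 ≤ b x y
  b_le : ∀ x y, b x y ≤ m y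
  m_int : Integrable m
  cont : ∀ z ∈ U, ∀ x, ∀ᵐ y, ∀ i j, ContinuousAt (fun x' => k z x' y i j) x
  holo : ∀ x y i j, DifferentiableOn ℂ (fun z => k z x y i j) U
  w_cont : Continuous w
  one_le_w : ∀ x, 1 ≤ w x
  w_le : ∀ x, w x ≤ W
  contract : ∀ x, ∫ y, b x y * w y ≤ 1 / 2 * w x

/-- One step of the Picard iteration `u ↦ e + ∫ k(·, y) u(y) dy`. -/
def picardStep (k : ℝ → ℝ → Matrix (Fin 2) (Fin 2) ℂ) (e : Fin 2 → ℂ)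
    (u : ℝ → Fin 2 → ℂ) (x : ℝ) : Fin 2 → ℂ :=
  e + ∫ y, (k x y).mulVec (u y)

namespace IsContractingKernel

variable {U : Set ℂ} {k : ℂ → ℝ → ℝ → Matrix (Fin 2) (Fin 2) ℂ} {b : ℝ → ℝ → ℝ}
  {m w : ℝ → ℝ} {W : ℝ} {z : ℂ} {u v : ℝ → Fin 2 → ℂ}

theorem m_nonneg (hk : IsContractingKernel U k b m w W) (y : ℝ) : 0 ≤ m y :=
  (hk.b_nonneg 0 y).trans (hk.b_le 0 y)

theorem w_pos (hk : IsContractingKernel U k b m w W) (y : ℝ) : 0 < w y :=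
  one_pos.trans_le (hk.one_le_w y)

theorem aestronglyMeasurable (hk : IsContractingKernel U k b m w W) (hz : z ∈ U)
    (hu : Continuous u) (x : ℝ) :
    AEStronglyMeasurable fun y => (k z x y).mulVec (u y) := by
  refine aestronglyMeasurable_iff_aemeasurable.2 (aemeasurable_pi_iff.2 fun i => ?_)
  refine AEStronglyMeasurable.aemeasurable ?_
  simp only [Matrix.mulVec, dotProduct]
  refine Finset.aestronglyMeasurable_fun_sum _ fun j _ => ?_
  exact (hk.meas z hz x i j).mul ((continuous_apply j).comp hu).aestronglyMeasurable

theorem norm_mulVec_le (hk : IsContractingKernel U k b m w W) (hz : z ∈ U) {M : ℝ}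
    (hM : ∀ x, ‖u x‖ ≤ M) (x y : ℝ) : ‖(k z x y).mulVec (u y)‖ ≤ m y * M :=
  (hk.bound z hz x y _).trans
    (mul_le_mul (hk.b_le x y) (hM y) (norm_nonneg _) (hk.m_nonneg y))

theorem integrable (hk : IsContractingKernel U k b m w W) (hz : z ∈ U)
    (hu : Continuous u) {M : ℝ} (hM : ∀ x, ‖u x‖ ≤ M) (x : ℝ) :
    Integrable fun y => (k z x y).mulVec (u y) :=
  (hk.m_int.mul_const M).mono' (hk.aestronglyMeasurable hz hu x)
    (Eventually.of_forall (hk.norm_mulVec_le hz hM x))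

/-- Dominated convergence needs continuity of the kernel in `x` only for almost every `y`, which
leaves room for the jump of a Volterra kernel at `y = x`. -/
theorem continuous_picardStep (hk : IsContractingKernel U k b m w W) (hz : z ∈ U)
    (hu : Continuous u) {M : ℝ} (hM : ∀ x, ‖u x‖ ≤ M) (e : Fin 2 → ℂ) :
    Continuous (picardStep (k z) e u) := by
  refine continuous_const.add (continuous_iff_continuousAt.2 fun x => ?_)
  refine continuousAt_of_dominated (Eventually.of_forall fun x => hk.aestronglyMeasurable hz hu x)
    (Eventually.of_forall fun x => Eventually.of_forall (hk.norm_mulVec_le hz hM x))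
    (hk.m_int.mul_const M) ?_
  filter_upwards [hk.cont z hz x] with y hy
  refine continuousAt_pi.2 fun i => ?_
  simp only [Matrix.mulVec, dotProduct]
  exact tendsto_finsetSum _ fun j _ => (hy i j).mul continuousAt_const

/-- In the norm `sup ‖u‖ / w` a Picard step halves distances. The bound `b x y` is used here rather
than `m y`, because it retains the dependence on `x` required by `contract`. -/
theorem norm_picardStep_sub_le (hk : IsContractingKernel U k b m w W) (hz : z ∈ U)
    (hu : Continuous u) (hv : Continuous v) {M N c : ℝ} (hM : ∀ x, ‖u x‖ ≤ M)
    (hN : ∀ x, ‖v x‖ ≤ N) (huv : ∀ x, ‖u x - v x‖ ≤ c * w x) (e : Fin 2 → ℂ) (x : ℝ) :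
    ‖picardStep (k z) e u x - picardStep (k z) e v x‖ ≤ c * (1 / 2) * w x := by
  have hc : 0 ≤ c := nonneg_of_mul_nonneg_left ((norm_nonneg _).trans (huv 0)) (hk.w_pos 0)
  have hbw : Integrable fun y => b x y * w y :=
    (hk.m_int.mul_const W).mono' ((hk.b_meas x).mul hk.w_cont.aestronglyMeasurable)
      (Eventually.of_forall fun y => by
        rw [Real.norm_of_nonneg (mul_nonneg (hk.b_nonneg x y) (hk.w_pos y).le)]
        exact mul_le_mul (hk.b_le x y) (hk.w_le y) (hk.w_pos y).le (hk.m_nonneg y))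
  rw [picardStep, picardStep, add_sub_add_left_eq_sub,
    ← integral_sub (hk.integrable hz hu hM x) (hk.integrable hz hv hN x)]
  calc ‖∫ y, ((k z x y).mulVec (u y) - (k z x y).mulVec (v y))‖
      ≤ ∫ y, c * (b x y * w y) := by
        refine norm_integral_le_of_norm_le (hbw.const_mul c) (Eventually.of_forall fun y => ?_)
        rw [← Matrix.mulVec_sub]
        calc _ ≤ b x y * ‖u y - v y‖ := hk.bound z hz x y _
          _ ≤ b x y * (c * w y) := mul_le_mul_of_nonneg_left (huv y) (hk.b_nonneg x y)
          _ = _ := by ring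
    _ = c * ∫ y, b x y * w y := integral_const_mul _ _
    _ ≤ c * (1 / 2 * w x) := mul_le_mul_of_nonneg_left (hk.contract x) hc
    _ = _ := by ring

theorem eq_of_fixed (hk : IsContractingKernel U k b m w W) (hz : z ∈ U)
    (hu : Continuous u) (hv : Continuous v) {M N : ℝ} (hM : ∀ x, ‖u x‖ ≤ M)
    (hN : ∀ x, ‖v x‖ ≤ N) {e : Fin 2 → ℂ} (hfu : ∀ x, u x = picardStep (k z) e u x)
    (hfv : ∀ x, v x = picardStep (k z) e v x) : u = v := by
  have h : ∀ n : ℕ, ∀ x, ‖u x - v x‖ ≤ (M + N) * (1 / 2) ^ n * w x := fun n => by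
    induction n with
    | zero =>
      intro x
      have h1 : ‖u x - v x‖ ≤ M + N := (norm_sub_le _ _).trans (add_le_add (hM x) (hN x))
      have h2 := hk.one_le_w x
      nlinarith [norm_nonneg (u x - v x)]
    | succ n ih =>
      intro x
      rw [hfu x, hfv x]
      refine (hk.norm_picardStep_sub_le hz hu hv hM hN ih e x).trans (le_of_eq ?_)
      ring
  funext x
  have hlim : Tendsto (fun n : ℕ => (M + N) * (1 / 2 : ℝ) ^ n * w x) atTop (𝓝 0) := by
    simpa using ((tendsto_pow_atTop_nhds_zero_of_lt_one (r := (1 / 2 : ℝ)) (by norm_num)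
      (by norm_num)).const_mul (M + N)).mul_const (w x)
  exact sub_eq_zero.1 (norm_le_zero_iff.1 (ge_of_tendsto' hlim fun n => h n x))

/-- The Picard iterates are continuous, bounded uniformly in `z` and holomorphic in `z`. -/
theorem picardIterate_regular (hk : IsContractingKernel U k b m w W) (hU : IsOpen U)
    (e : Fin 2 → ℂ) (n : ℕ) :
    (∀ z ∈ U, Continuous ((picardStep (k z) e)^[n] fun _ => e)) ∧
      (∃ M, ∀ z ∈ U, ∀ x, ‖(picardStep (k z) e)^[n] (fun _ => e) x‖ ≤ M) ∧
      ∀ x, DifferentiableOn ℂ (fun z => (picardStep (k z) e)^[n] (fun _ => e) x) U := by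
  induction n with
  | zero => exact ⟨fun _ _ => continuous_const, ⟨‖e‖, fun _ _ _ => le_rfl⟩,
      fun _ => differentiableOn_const _⟩
  | succ n ih =>
    obtain ⟨hc, ⟨M, hM⟩, hd⟩ := ih
    simp only [Function.iterate_succ_apply']
    refine ⟨fun z hz => hk.continuous_picardStep hz (hc z hz) (hM z hz) e,
      ⟨‖e‖ + ∫ y, m y * M, fun z hz x => (norm_add_le _ _).trans (add_le_add le_rfl ?_)⟩,
      fun x => (differentiableOn_const _).add ?_⟩
    · exact norm_integral_le_of_norm_le (hk.m_int.mul_const M)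
        (Eventually.of_forall (hk.norm_mulVec_le hz (hM z hz) x))
    · refine differentiableOn_integral_of_dominated hU
        (fun z hz => hk.aestronglyMeasurable hz (hc z hz) x) (hk.m_int.mul_const M)
        (fun z hz => hk.norm_mulVec_le hz (hM z hz) x) fun y => ?_
      refine differentiableOn_pi.2 fun i => ?_
      simp only [Matrix.mulVec, dotProduct]
      exact DifferentiableOn.fun_sum fun j _ =>
        (hk.holo x y i j).mul (differentiableOn_pi.1 (hd y) j)

/-- The Volterra equation has a bounded continuous solution that is holomorphic in `z`. -/
theorem exists_solution (hk : IsContractingKernel U k b m w W) (hU : IsOpen U) (e : Fin 2 → ℂ) :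
    ∃ u : ℂ → ℝ → Fin 2 → ℂ,
      (∀ z ∈ U, Continuous (u z) ∧ (∃ M, ∀ x, ‖u z x‖ ≤ M) ∧
        ∀ x, u z x = picardStep (k z) e (u z) x) ∧
      ∀ x, DifferentiableOn ℂ (fun z => u z x) U := by
  set it : ℕ → ℂ → ℝ → Fin 2 → ℂ := fun n z => (picardStep (k z) e)^[n] fun _ => e with hit
  have hreg := hk.picardIterate_regular hU e
  obtain ⟨M₁, hM₁⟩ := (hreg 1).2.1
  have hsucc : ∀ n z, it (n + 1) z = picardStep (k z) e (it n z) := fun n z =>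
    Function.iterate_succ_apply' _ _ _
  have hstep : ∀ n, ∀ z ∈ U, ∀ x,
      ‖it (n + 1) z x - it n z x‖ ≤ (M₁ + ‖e‖) * (1 / 2) ^ n * w x := fun n => by
    induction n with
    | zero =>
      intro z hz x
      have h1 : ‖it (0 + 1) z x - it 0 z x‖ ≤ M₁ + ‖e‖ :=
        (norm_sub_le _ _).trans (add_le_add (hM₁ z hz x) le_rfl)
      have h2 := hk.one_le_w x
      nlinarith [norm_nonneg (it (0 + 1) z x - it 0 z x)]
    | succ n ih =>
      intro z hz x
      obtain ⟨M, hM⟩ := (hreg n).2.1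
      obtain ⟨N, hN⟩ := (hreg (n + 1)).2.1
      have h := hk.norm_picardStep_sub_le hz ((hreg (n + 1)).1 z hz) ((hreg n).1 z hz) (hN z hz)
        (hM z hz) (ih z hz) e x
      change ‖picardStep (k z) e (it (n + 1) z) x - picardStep (k z) e (it n z) x‖ ≤ _ at h
      rw [← hsucc (n + 1) z, ← hsucc n z] at h
      exact h.trans (le_of_eq (by ring))
  -- A point of `U` is needed to see that `M₁ + ‖e‖` is nonnegative.
  rcases U.eq_empty_or_nonempty with rfl | ⟨z₀, hz₀⟩
  · exact ⟨fun _ _ => 0, by simp, by simp⟩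
  have hM₁0 : 0 ≤ M₁ + ‖e‖ := add_nonneg ((norm_nonneg _).trans (hM₁ z₀ hz₀ 0)) (norm_nonneg _)
  -- Replacing `w` by its upper bound `W` gives a geometric rate uniform in both `z` and `x`.
  set A := (M₁ + ‖e‖) * W
  have hdist : ∀ z ∈ U, ∀ x n, dist (it n z x) (it (n + 1) z x) ≤ A * (1 / 2) ^ n :=
    fun z hz x n => by
    rw [dist_comm, dist_eq_norm]
    refine (hstep n z hz x).trans ?_
    have := mul_le_mul_of_nonneg_left (hk.w_le x)
      (mul_nonneg hM₁0 (pow_nonneg (by norm_num : (0 : ℝ) ≤ 1 / 2) n))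
    refine this.trans (le_of_eq ?_)
    simp only [A]; ring
  have hex : ∀ z x, ∃ l, z ∈ U → Tendsto (fun n => it n z x) atTop (𝓝 l) := fun z x => by
    by_cases hz : z ∈ U
    · obtain ⟨l, hl⟩ := cauchySeq_tendsto_of_complete
        (cauchySeq_of_le_geometric (1 / 2) A (by norm_num) (hdist z hz x))
      exact ⟨l, fun _ => hl⟩
    · exact ⟨0, fun h => absurd h hz⟩
  choose u hu using hex
  have hrate : ∀ z ∈ U, ∀ x n, dist (it n z x) (u z x) ≤ A * (1 / 2) ^ n / (1 - 1 / 2) :=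
    fun z hz x n => dist_le_of_le_geometric_of_tendsto (1 / 2) A (by norm_num) (hdist z hz x)
      (hu z x hz) n
  have hrate0 : Tendsto (fun n : ℕ => A * (1 / 2 : ℝ) ^ n / (1 - 1 / 2)) atTop (𝓝 0) := by
    simpa using ((tendsto_pow_atTop_nhds_zero_of_lt_one (r := (1 / 2 : ℝ)) (by norm_num)
      (by norm_num)).const_mul A).div_const (1 - 1 / 2)
  -- Every iterate is within `2 * A` of the limit, hence within `4 * A` of the initial iterate `e`.
  have hbd : ∀ z ∈ U, ∀ x n, ‖it n z x‖ ≤ ‖e‖ + 4 * A := by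
    have key : ∀ z ∈ U, ∀ x n, dist (it n z x) (u z x) ≤ 2 * A := fun z hz x n => by
      refine (hrate z hz x n).trans ?_
      have hA : 0 ≤ A := mul_nonneg hM₁0 (zero_le_one.trans ((hk.one_le_w 0).trans (hk.w_le 0)))
      have : (1 / 2 : ℝ) ^ n ≤ 1 := pow_le_one₀ (by norm_num) (by norm_num)
      have := mul_le_mul_of_nonneg_left this hA
      rw [div_le_iff₀ (by norm_num)]
      linarith
    intro z hz x n
    have h1 := dist_triangle_right (it n z x) (it 0 z x) (u z x)
    have h2 := key z hz x n
    have h3 := key z hz x 0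
    have h4 : ‖it n z x‖ ≤ ‖it 0 z x‖ + dist (it n z x) (it 0 z x) := by
      rw [dist_eq_norm]; exact norm_le_norm_add_norm_sub' _ _
    have h5 : ‖it 0 z x‖ = ‖e‖ := rfl
    linarith
  have hub : ∀ z ∈ U, ∀ x, ‖u z x‖ ≤ ‖e‖ + 4 * A := fun z hz x =>
    le_of_tendsto (hu z x hz).norm (Eventually.of_forall (hbd z hz x))
  refine ⟨u, fun z hz => ⟨?_, ⟨_, hub z hz⟩, fun x => ?_⟩, fun x => ?_⟩
  · have : TendstoUniformly (fun n x => it n z x) (u z) atTop := by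
      rw [Metric.tendstoUniformly_iff]
      intro ε hε
      filter_upwards [hrate0.eventually_lt_const hε] with n hn x
      rw [dist_comm]
      exact (hrate z hz x n).trans_lt hn
    exact this.continuous (Frequently.of_forall fun n => (hreg n).1 z hz)
  · have h1 : Tendsto (fun n => it (n + 1) z x) atTop (𝓝 (u z x)) :=
      (hu z x hz).comp (tendsto_add_atTop_nat 1)
    have h2 : Tendsto (fun n => it (n + 1) z x) atTop (𝓝 (picardStep (k z) e (u z) x)) := by
      simp only [hsucc]
      refine tendsto_const_nhds.add (tendsto_integral_of_dominated_convergence _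
        (fun n => hk.aestronglyMeasurable hz ((hreg n).1 z hz) x)
        (hk.m_int.mul_const (‖e‖ + 4 * A))
        (fun n => Eventually.of_forall (hk.norm_mulVec_le hz (fun y => hbd z hz y n) x))
        (Eventually.of_forall fun y => ?_))
      exact ((continuous_const.matrix_mulVec continuous_id).tendsto _).comp (hu z y hz)
    exact tendsto_nhds_unique h1 h2
  · have : TendstoUniformlyOn (fun n z => it n z x) (fun z => u z x) atTop U := by
      rw [Metric.tendstoUniformlyOn_iff]
      intro ε hε
      filter_upwards [hrate0.eventually_lt_const hε] with n hn z hz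
      rw [dist_comm]
      exact (hrate z hz x n).trans_lt hn
    exact this.tendstoLocallyUniformlyOn.differentiableOn
      (Eventually.of_forall fun n => (hreg n).2.2 x) hU

end IsContractingKernel

/-! ### The Jost equations as contracting Volterra equations -/

/-- Cauchy–Schwarz applied to `q = ⟨x⟩⁻¹ · ⟨x⟩ q`, a product of two `L²` functions. -/
theorem MemWeightedSobolev.integrable {q : ℝ → ℂ} (h : MemWeightedSobolev 1 1 q) :
    Integrable q := by
  obtain ⟨g, rfl, -, hg⟩ := h
  obtain ⟨hg1, hg2⟩ := hg 0 (Nat.zero_le _)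
  have hpos : ∀ x, 0 < bracket x := fun x => Real.sqrt_pos.2 (by positivity)
  have hcont : Continuous bracket := by unfold bracket; fun_prop
  have hinv : MemLp (fun x => (((bracket x)⁻¹ : ℝ) : ℂ)) 2 := by
    have hm : AEStronglyMeasurable (fun x => (((bracket x)⁻¹ : ℝ) : ℂ)) := by
      refine Continuous.aestronglyMeasurable ?_
      exact Complex.continuous_ofReal.comp (hcont.inv₀ fun x => (hpos x).ne')
    refine (memLp_two_iff_integrable_sq_norm hm).2 (integrable_inv_one_add_sq.congr ?_)
    refine Eventually.of_forall fun x => ?_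
    simp only [Complex.norm_real, norm_inv, Real.norm_of_nonneg (hpos x).le, inv_pow]
    rw [bracket, Real.sq_sqrt (by positivity), sq_abs]
  refine (hinv.integrable_mul hg2).congr (Eventually.of_forall fun x => ?_)
  simp only [Pi.mul_apply, Real.rpow_one, Complex.ofReal_inv]
  rw [inv_mul_cancel_left₀ (Complex.ofReal_ne_zero.2 (hpos x).ne')]

theorem MemWeightedSobolev.integrable_norm_sq {k : ℕ} {s : ℝ} {q : ℝ → ℂ}
    (h : MemWeightedSobolev k s q) : Integrable fun x => ‖q x‖ ^ 2 := by
  obtain ⟨g, rfl, -, hg⟩ := h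
  have := (hg 0 (Nat.zero_le _)).1
  exact (memLp_two_iff_integrable_sq_norm this.1).1 this

/-- The kernel of the Volterra equation for the `j`-th column, integrated over `S x` with
constant factor `c`. -/
def jostKernel (S : ℝ → Set ℝ) (c : ℂ) (q : ℝ → ℂ) (j : Fin 2) (z : ℂ) (x y : ℝ) :
    Matrix (Fin 2) (Fin 2) ℂ :=
  (S x).indicator (fun y => c • (columnPropagator z j (x - y) * Utilde q z y)) y

/-- Bounded continuous solutions of the Volterra equation with kernel `jostKernel S c q j z`. -/
def IsJostSolution (S : ℝ → Set ℝ) (c : ℂ) (q : ℝ → ℂ) (j : Fin 2) (z : ℂ)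
    (u : ℝ → Fin 2 → ℂ) : Prop :=
  Continuous u ∧ (∃ M : ℝ, ∀ x, ‖u x‖ ≤ M) ∧
    ∀ x, u x = picardStep (jostKernel S c q j z) (Pi.single j 1) u x

/-- The integration domains for which the Volterra operators contract. -/
structure IsVolterraDomain (S : ℝ → Set ℝ) : Prop where
  measurableSet : ∀ x, MeasurableSet (S x)
  eventually_mem_iff : ∀ x y, y ≠ x → ∀ᶠ x' in 𝓝 x, (y ∈ S x' ↔ y ∈ S x)
  exists_weight : ∀ m : ℝ → ℝ, Integrable m →
    ∃ (w : ℝ → ℝ) (W : ℝ), Continuous w ∧ (∀ x, 1 ≤ w x) ∧ (∀ x, w x ≤ W) ∧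
      ∀ x, ∫ y in S x, m y * w y ≤ 1 / 2 * w x

theorem isVolterraDomain_Iic : IsVolterraDomain Iic where
  measurableSet _ := measurableSet_Iic
  eventually_mem_iff x y hxy := by
    rcases lt_or_gt_of_ne hxy with h | h
    · filter_upwards [lt_mem_nhds h] with x' hx'
      simp [h.le, hx'.le]
    · filter_upwards [gt_mem_nhds h] with x' hx'
      simp [not_le.2 h, not_le.2 hx']
  exists_weight _ := exists_weight_Iic

theorem isVolterraDomain_Ioi : IsVolterraDomain Ioi where
  measurableSet _ := measurableSet_Ioi
  eventually_mem_iff x y hxy := by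
    rcases lt_or_gt_of_ne hxy with h | h
    · filter_upwards [lt_mem_nhds h] with x' hx'
      simp [not_lt.2 h.le, not_lt.2 hx'.le]
    · filter_upwards [gt_mem_nhds h] with x' hx'
      simp [h, hx']
  exists_weight _ := exists_weight_Ioi

theorem picardStep_jostKernel {S : ℝ → Set ℝ} (hS : IsVolterraDomain S) (c : ℂ) (q : ℝ → ℂ)
    (j : Fin 2) (z : ℂ) (e : Fin 2 → ℂ) (u : ℝ → Fin 2 → ℂ) (x : ℝ) :
    picardStep (jostKernel S c q j z) e u x = e + c • ∫ y in S x,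
      Matrix.mulVec (columnPropagator z j (x - y) * Utilde q z y) (u y) := by
  rw [picardStep, ← integral_smul, ← integral_indicator (hS.measurableSet x)]
  congr 1
  refine integral_congr_ae (Eventually.of_forall fun y => ?_)
  by_cases hy : y ∈ S x <;> simp [jostKernel, hy, Matrix.smul_mulVec]

theorem isJostMinus_eq (q : ℝ → ℂ) (z : ℂ) (j : Fin 2) :
    IsJostMinus q z j = IsJostSolution Iic 1 q j z := by
  funext u
  simp only [IsJostMinus, IsJostSolution, picardStep_jostKernel isVolterraDomain_Iic, one_smul]

theorem isJostPlus_eq (q : ℝ → ℂ) (z : ℂ) (j : Fin 2) :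
    IsJostPlus q z j = IsJostSolution Ioi (-1) q j z := by
  funext u
  simp only [IsJostPlus, IsJostSolution, picardStep_jostKernel isVolterraDomain_Ioi, neg_smul,
    one_smul, sub_eq_add_neg]

theorem columnPropagator_mul_apply (q : ℝ → ℂ) (z : ℂ) (j : Fin 2) (s y : ℝ) (i l : Fin 2) :
    (columnPropagator z j s * Utilde q z y) i l =
      Complex.exp (-Complex.I * z ^ 2 * s * (sigma3 i i - sigma3 j j)) * Utilde q z y i l := by
  rw [columnPropagator, Matrix.diagonal_mul]

/-- The sign condition bounds the exponentials by `1`; each row of `Ũ` has one entry of size `‖q‖² /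
4` and one of size `‖z‖ ‖q‖`. -/
theorem norm_columnPropagator_mul_mulVec_le (q : ℝ → ℂ) (z : ℂ) (j : Fin 2) (s y : ℝ)
    (hs : ∀ i, (-Complex.I * z ^ 2 * s * (sigma3 i i - sigma3 j j)).re ≤ 0) (v : Fin 2 → ℂ) :
    ‖(columnPropagator z j s * Utilde q z y).mulVec v‖ ≤
      (1 / 4 * ‖q y‖ ^ 2 + ‖z‖ * ‖q y‖) * ‖v‖ := by
  have hU : ‖(Utilde q z y).mulVec v‖ ≤ (1 / 4 * ‖q y‖ ^ 2 + ‖z‖ * ‖q y‖) * ‖v‖ := by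
    have h0 := norm_le_pi_norm v 0
    have h1 := norm_le_pi_norm v 1
    refine (pi_norm_le_iff_of_nonneg (by positivity)).2 fun i => ?_
    fin_cases i
    · simp [Utilde, Matrix.mulVec, dotProduct, sigma3, potentialQ, Fin.sum_univ_two]
      refine (norm_add_le _ _).trans ?_
      simp only [norm_mul, norm_div, Complex.norm_I, RCLike.norm_conj, RCLike.norm_ofNat]
      calc _ ≤ 1 / 4 * (‖q y‖ * ‖q y‖) * ‖v‖ + ‖z‖ * ‖q y‖ * ‖v‖ := by gcongr
        _ = _ := by ring
    · simp [Utilde, Matrix.mulVec, dotProduct, sigma3, potentialQ, Fin.sum_univ_two]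
      refine (norm_add_le _ _).trans ?_
      simp only [norm_neg, norm_mul, norm_div, Complex.norm_I, RCLike.norm_conj,
        RCLike.norm_ofNat]
      calc _ ≤ ‖z‖ * ‖q y‖ * ‖v‖ + 1 / 4 * (‖q y‖ * ‖q y‖) * ‖v‖ := by gcongr
        _ = _ := by ring
  refine (pi_norm_le_iff_of_nonneg (by positivity)).2 fun i => ?_
  rw [← Matrix.mulVec_mulVec, columnPropagator, Matrix.mulVec_diagonal, norm_mul, Complex.norm_exp]
  have h1 := Real.exp_le_one_iff.2 (hs i)
  exact (mul_le_of_le_one_left (norm_nonneg _) h1).trans ((norm_le_pi_norm _ i).trans hU)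

theorem aestronglyMeasurable_Utilde {q : ℝ → ℂ} (hq : AEStronglyMeasurable q) (z : ℂ)
    (i l : Fin 2) : AEStronglyMeasurable fun y => Utilde q z y i l := by
  have hc : AEStronglyMeasurable fun y => conj (q y) :=
    Complex.continuous_conj.comp_aestronglyMeasurable hq
  have h1 := (hq.mul hc).const_mul (Complex.I / 4)
  fin_cases i <;> fin_cases l <;> simp [Utilde, sigma3, potentialQ]
  · exact h1
  · exact hq.const_mul _
  · exact (hc.const_mul _).neg
  · exact h1.neg

theorem differentiable_Utilde (q : ℝ → ℂ) (y : ℝ) (i l : Fin 2) :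
    Differentiable ℂ fun z => Utilde q z y i l := by
  simp only [Utilde, Matrix.add_apply, Matrix.smul_apply, smul_eq_mul]
  fun_prop

variable {S : ℝ → Set ℝ} {c : ℂ} {q : ℝ → ℂ} {j : Fin 2} {D : Set ℂ}

/-- The majorant of `Ũ` grows with `‖z‖`, so the spectral parameter is confined to a ball;
holomorphy and uniqueness are local enough for this. -/
theorem exists_isContractingKernel (hS : IsVolterraDomain S) (hc : ‖c‖ = 1)
    (hq : Integrable q) (hq2 : Integrable fun x => ‖q x‖ ^ 2)
    (hsign : ∀ z ∈ D, ∀ x, ∀ y ∈ S x, ∀ i,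
      (-Complex.I * z ^ 2 * (x - y : ℝ) * (sigma3 i i - sigma3 j j)).re ≤ 0) {R : ℝ} (hR : 0 ≤ R) :
    ∃ b m w W, IsContractingKernel (D ∩ Metric.ball 0 R) (jostKernel S c q j) b m w W := by
  set m : ℝ → ℝ := fun y => 1 / 4 * ‖q y‖ ^ 2 + R * ‖q y‖ with hm
  have hmi : Integrable m := (hq2.const_mul _).add (hq.norm.const_mul _)
  have hm0 : ∀ y, 0 ≤ m y := fun y => by positivity
  obtain ⟨w, W, hwc, hw1, hwW, hw⟩ := hS.exists_weight m hmi
  refine ⟨fun x => (S x).indicator m, m, w, W, ?_, ?_, ?_, ?_, ?_, hmi, ?_, ?_, hwc, hw1, hwW, ?_⟩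
  · intro z _ x i l
    have : (fun y => jostKernel S c q j z x y i l) = (S x).indicator fun y => c *
        (Complex.exp (-Complex.I * z ^ 2 * (x - y : ℝ) * (sigma3 i i - sigma3 j j)) *
          Utilde q z y i l) := by
      funext y
      by_cases hy : y ∈ S x <;> simp [jostKernel, hy, columnPropagator_mul_apply]
    rw [this]
    refine (((Continuous.aestronglyMeasurable ?_).mul
      (aestronglyMeasurable_Utilde hq.1 z i l)).const_mul c).indicator (hS.measurableSet x)
    fun_prop
  · rintro z ⟨hz, hzR⟩ x y v
    by_cases hy : y ∈ S x
    · simp only [jostKernel, indicator_of_mem hy, Matrix.smul_mulVec, norm_smul, hc, one_mul]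
      refine (norm_columnPropagator_mul_mulVec_le q z j _ y (hsign z hz x y hy) v).trans ?_
      have : ‖z‖ ≤ R := (mem_ball_zero_iff.1 hzR).le
      simp only [hm]
      gcongr
    · simp [jostKernel, hy]
  · exact fun x => hmi.1.indicator (hS.measurableSet x)
  · exact fun x y => indicator_nonneg (fun y _ => hm0 y) y
  · exact fun x y => indicator_le_self' (fun y _ => hm0 y) y
  · intro z _ x
    filter_upwards [(measure_eq_zero_iff_ae_notMem.1 (Real.volume_singleton (a := x)))] with y hy i l
    have hev := hS.eventually_mem_iff x y hy
    by_cases hyx : y ∈ S x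
    · have : (fun x' => c * (Complex.exp (-Complex.I * z ^ 2 * (x' - y : ℝ) *
          (sigma3 i i - sigma3 j j)) * Utilde q z y i l)) =ᶠ[𝓝 x]
          fun x' => jostKernel S c q j z x' y i l := by
        filter_upwards [hev] with x' hx'
        simp [jostKernel, hx'.2 hyx, columnPropagator_mul_apply]
      refine ContinuousAt.congr (Continuous.continuousAt ?_) this
      fun_prop
    · have : (fun _ => (0 : ℂ)) =ᶠ[𝓝 x] fun x' => jostKernel S c q j z x' y i l := by
        filter_upwards [hev] with x' hx'
        simp [jostKernel, mt hx'.1 hyx]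
      exact continuousAt_const.congr this
  · intro x y i l
    by_cases hy : y ∈ S x
    · simp only [jostKernel, indicator_of_mem hy, Matrix.smul_apply, columnPropagator_mul_apply,
        smul_eq_mul]
      have := differentiable_Utilde q y i l
      exact Differentiable.differentiableOn (by fun_prop)
    · simp [jostKernel, hy]
  · intro x
    have hwx := hw x
    rw [← integral_indicator (hS.measurableSet x)] at hwx
    refine le_of_eq_of_le (integral_congr_ae (Eventually.of_forall fun y => ?_)) hwx
    by_cases hy : y ∈ S x <;> simp [hy]

theorem existsUnique_isJostSolution (hS : IsVolterraDomain S) (hc : ‖c‖ = 1)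
    (hq : Integrable q) (hq2 : Integrable fun x => ‖q x‖ ^ 2) (hD : IsOpen D)
    (hsign : ∀ z ∈ D, ∀ x, ∀ y ∈ S x, ∀ i,
      (-Complex.I * z ^ 2 * (x - y : ℝ) * (sigma3 i i - sigma3 j j)).re ≤ 0) {z : ℂ}
    (hz : z ∈ D) : ∃! u, IsJostSolution S c q j z u := by
  obtain ⟨b, m, w, W, hk⟩ := exists_isContractingKernel hS hc hq hq2 hsign (R := ‖z‖ + 1) (by positivity)
  have hzU : z ∈ D ∩ Metric.ball 0 (‖z‖ + 1) := ⟨hz, by simp⟩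
  obtain ⟨u, hu, -⟩ := hk.exists_solution (hD.inter Metric.isOpen_ball) (Pi.single j 1)
  refine ⟨u z, hu z hzU, fun v hv => ?_⟩
  obtain ⟨hvc, ⟨N, hN⟩, hvf⟩ := hv
  obtain ⟨huc, ⟨M, hM⟩, huf⟩ := hu z hzU
  exact hk.eq_of_fixed hzU hvc huc hN hM hvf huf

theorem differentiableOn_jostSolution (hS : IsVolterraDomain S) (hc : ‖c‖ = 1)
    (hq : Integrable q) (hq2 : Integrable fun x => ‖q x‖ ^ 2) (hD : IsOpen D)
    (hsign : ∀ z ∈ D, ∀ x, ∀ y ∈ S x, ∀ i,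
      (-Complex.I * z ^ 2 * (x - y : ℝ) * (sigma3 i i - sigma3 j j)).re ≤ 0) (x : ℝ) :
    DifferentiableOn ℂ (fun z => Classical.epsilon (IsJostSolution S c q j z) x) D := by
  intro z hz
  obtain ⟨b, m, w, W, hk⟩ := exists_isContractingKernel hS hc hq hq2 hsign (R := ‖z‖ + 1) (by positivity)
  have hzU : z ∈ D ∩ Metric.ball 0 (‖z‖ + 1) := ⟨hz, by simp⟩
  have hU := hD.inter (Metric.isOpen_ball (x := (0 : ℂ)) (ε := ‖z‖ + 1))
  obtain ⟨u, hu, hd⟩ := hk.exists_solution hU (Pi.single j 1)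
  -- By uniqueness the chosen solution coincides on the ball with the holomorphic Picard limit.
  refine (((hd x).congr fun t ht => ?_).differentiableAt (hU.mem_nhds hzU)).differentiableWithinAt
  have hex := existsUnique_isJostSolution hS hc hq hq2 hD hsign ht.1
  exact congrFun (hex.unique (Classical.epsilon_spec hex.exists) (hu t ht)) x

/-! ### The symmetry under reversal of the spectral parameter -/

/-- The diagonal part of `Ũ` is even in `z` and commutes with `σ₃`; the off-diagonal part is odd and
anticommutes. -/
theorem Utilde_neg (q : ℝ → ℂ) (z : ℂ) (y : ℝ) :
    Utilde q (-z) y * sigma3 = sigma3 * Utilde q z y := by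
  ext i l
  fin_cases i <;> fin_cases l <;> simp [Utilde, sigma3, potentialQ]

theorem jostKernel_neg_mulVec (z : ℂ) (x y : ℝ) (v : Fin 2 → ℂ) :
    (jostKernel S c q j (-z) x y).mulVec (sigma3.mulVec v) =
      sigma3.mulVec ((jostKernel S c q j z x y).mulVec v) := by
  by_cases hy : y ∈ S x
  · have hcomm : columnPropagator z j (x - y) * sigma3 = sigma3 * columnPropagator z j (x - y) := by
      have : sigma3 = Matrix.diagonal fun i => sigma3 i i := by
        ext i l
        fin_cases i <;> fin_cases l <;> simp [sigma3]
      rw [this, columnPropagator, Matrix.diagonal_mul_diagonal, Matrix.diagonal_mul_diagonal]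
      simp only [mul_comm]
    have hneg : columnPropagator (-z) j (x - y) = columnPropagator z j (x - y) := by
      simp [columnPropagator]
    simp only [jostKernel, indicator_of_mem hy, Matrix.mulVec_mulVec]
    rw [hneg, Matrix.smul_mul, Matrix.mul_smul, Matrix.mul_assoc, Utilde_neg, ← Matrix.mul_assoc,
      hcomm, Matrix.mul_assoc]
  · simp [jostKernel, hy]

/-- The symmetry of the Jost functions under `z ↦ -z`. -/
theorem jostSolution_neg (hS : IsVolterraDomain S) (hc : ‖c‖ = 1)
    (hq : Integrable q) (hq2 : Integrable fun x => ‖q x‖ ^ 2) (hD : IsOpen D)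
    (hsign : ∀ z ∈ D, ∀ x, ∀ y ∈ S x, ∀ i,
      (-Complex.I * z ^ 2 * (x - y : ℝ) * (sigma3 i i - sigma3 j j)).re ≤ 0) {z : ℂ}
    (hz : z ∈ D) (hz' : -z ∈ D) (x : ℝ) :
    Classical.epsilon (IsJostSolution S c q j (-z)) x =
      sigma3 j j • sigma3.mulVec (Classical.epsilon (IsJostSolution S c q j z) x) := by
  have hex := existsUnique_isJostSolution hS hc hq hq2 hD hsign hz
  have hex' := existsUnique_isJostSolution hS hc hq hq2 hD hsign hz'
  set u := Classical.epsilon (IsJostSolution S c q j z)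
  obtain ⟨huc, ⟨M, hM⟩, huf⟩ : IsJostSolution S c q j z u := Classical.epsilon_spec hex.exists
  obtain ⟨b, m, w, W, hk⟩ := exists_isContractingKernel hS hc hq hq2 hsign (R := ‖z‖ + 1) (by positivity)
  have hzU : z ∈ D ∩ Metric.ball 0 (‖z‖ + 1) := ⟨hz, by simp⟩
  -- The sign `sigma3 j j` is chosen so that `L` fixes the inhomogeneity `Pi.single j 1`.
  set L : (Fin 2 → ℂ) →L[ℂ] (Fin 2 → ℂ) :=
    LinearMap.toContinuousLinearMap (sigma3 j j • sigma3.mulVecLin)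
  have hL : ∀ v, L v = sigma3 j j • sigma3.mulVec v := fun v => rfl
  refine congrFun (hex'.unique (y₂ := fun x => L (u x)) (Classical.epsilon_spec hex'.exists)
    ⟨L.continuous.comp huc, ⟨‖L‖ * M, fun x => L.le_opNorm_of_le (hM x)⟩, fun x => ?_⟩) x
  simp only
  rw [huf x, picardStep, picardStep, map_add,
    ← L.integral_comp_comm (hk.integrable hzU huc hM x)]
  congr 1
  · rw [hL]
    funext i
    fin_cases j <;> fin_cases i <;> simp [sigma3]
  · congr 1
    funext y
    rw [hL, hL, Matrix.mulVec_smul, jostKernel_neg_mulVec]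

/-! ### Algebra of the Darboux matrix -/

/-- The polynomial part of the Darboux matrix. -/
def darbouxNumerator (Φ : Fin 2 → ℂ) (z w : ℂ) : Matrix (Fin 2) (Fin 2) ℂ :=
  !![coeffC w Φ ^ (1 / 2 : ℂ) * z ^ 2 - (‖w‖ : ℂ) ^ 2 * conj (coeffC w Φ) ^ (1 / 2 : ℂ),
     -(coeffD w Φ * conj (coeffC w Φ) ^ (1 / 2 : ℂ) * z);
     conj (coeffD w Φ) * coeffC w Φ ^ (1 / 2 : ℂ) * z,
     conj (coeffC w Φ) ^ (1 / 2 : ℂ) * z ^ 2 - (‖w‖ : ℂ) ^ 2 * coeffC w Φ ^ (1 / 2 : ℂ)]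

theorem darboux_eq_smul (Φ : Fin 2 → ℂ) (z w : ℂ) :
    darboux Φ z w = (z ^ 2 - w ^ 2)⁻¹ •
      ((w ^ (1 / 2 : ℂ) / conj w ^ (1 / 2 : ℂ)) • darbouxNumerator Φ z w) := by
  rw [darboux, darbouxNumerator, smul_smul]
  congr 1
  rw [show conj w ^ (1 / 2 : ℂ) * z ^ 2 - w ^ 2 * conj w ^ (1 / 2 : ℂ) =
    conj w ^ (1 / 2 : ℂ) * (z ^ 2 - w ^ 2) by ring, ← div_div, div_eq_inv_mul _ (z ^ 2 - w ^ 2)]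

theorem formM_re (w : ℂ) (Φ : Fin 2 → ℂ) :
    (formM w Φ Φ).re = w.re * (Complex.normSq (Φ 0) + Complex.normSq (Φ 1)) := by
  simp only [formM, mul_assoc, Complex.mul_conj, Complex.add_re, Complex.re_mul_ofReal,
    Complex.conj_re]
  ring

theorem formM_conj (w : ℂ) (Φ : Fin 2 → ℂ) : formM (conj w) Φ Φ = conj (formM w Φ Φ) := by
  simp only [formM, map_add, map_mul, Complex.conj_conj]
  ring

/-- A negative real `C` with `C m = conj m` would give `re m` and `C.re * re m` the same value,
impossible for `re m > 0`. Off the cut, the principal root commutes with conjugation. -/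
theorem coeffC_arg_ne_pi {w : ℂ} {Φ : Fin 2 → ℂ} (h : 0 < (formM w Φ Φ).re) :
    (coeffC w Φ).arg ≠ Real.pi := by
  intro harg
  obtain ⟨h1, h2⟩ := Complex.arg_eq_pi_iff.1 harg
  have hne : formM w Φ Φ ≠ 0 := fun h0 => by simp [h0] at h
  have hmul : coeffC w Φ * formM w Φ Φ = conj (formM w Φ Φ) := by
    rw [coeffC, formM_conj, div_mul_cancel₀ _ hne]
  have hre := congrArg Complex.re hmul
  rw [Complex.mul_re, h2, Complex.conj_re] at hre
  nlinarith

theorem sqrt_coeffC_mul_conj {w : ℂ} {Φ : Fin 2 → ℂ} (h : 0 < (formM w Φ Φ).re) :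
    coeffC w Φ ^ (1 / 2 : ℂ) * conj (coeffC w Φ) ^ (1 / 2 : ℂ) = 1 := by
  have hne : formM w Φ Φ ≠ 0 := fun h0 => by simp [h0] at h
  have hn : ‖coeffC w Φ‖ = 1 := by
    rw [coeffC, formM_conj, norm_div, RCLike.norm_conj, div_self (norm_ne_zero_iff.2 hne)]
  rw [Complex.conj_cpow _ _ (coeffC_arg_ne_pi h)]
  have h2 : conj (1 / 2 : ℂ) = 1 / 2 := by simp [Complex.conj_ofNat]
  rw [h2, Complex.mul_conj, Complex.normSq_eq_norm_sq]
  have h3 : ‖coeffC w Φ ^ (1 / 2 : ℂ)‖ ^ 2 = 1 := by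
    rw [← norm_pow, ← Complex.cpow_nat_mul]
    simp [hn]
  rw [h3, Complex.ofReal_one]

/-- The Darboux matrix annihilates the vector it is built from at `z = w`. -/
theorem darbouxNumerator_mulVec_self {w : ℂ} (hw : 0 < w.re) (Φ : Fin 2 → ℂ) :
    (darbouxNumerator Φ w w).mulVec Φ = 0 := by
  by_cases hΦ : Φ = 0
  · rw [hΦ, Matrix.mulVec_zero]
  have hpos : 0 < (formM w Φ Φ).re := by
    rw [formM_re]
    refine mul_pos hw ?_
    by_contra hle
    have h0 := Complex.normSq_nonneg (Φ 0)
    have h1 := Complex.normSq_nonneg (Φ 1)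
    refine hΦ (funext fun i => ?_)
    rw [not_lt] at hle
    obtain rfl | rfl : i = 0 ∨ i = 1 := by omega
    · exact Complex.normSq_eq_zero.1 (le_antisymm (by linarith) h0)
    · exact Complex.normSq_eq_zero.1 (le_antisymm (by linarith) h1)
  have hne : formM w Φ Φ ≠ 0 := fun h0 => by simp [h0] at hpos
  have hne' : conj (formM w Φ Φ) ≠ 0 := (map_ne_zero _).2 hne
  have hst := sqrt_coeffC_mul_conj hpos
  have hss : coeffC w Φ ^ (1 / 2 : ℂ) * coeffC w Φ ^ (1 / 2 : ℂ) = coeffC w Φ := by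
    rw [← sq, ← Complex.cpow_nat_mul]; simp
  have htt : conj (coeffC w Φ) ^ (1 / 2 : ℂ) * conj (coeffC w Φ) ^ (1 / 2 : ℂ) =
      conj (coeffC w Φ) := by
    rw [← sq, ← Complex.cpow_nat_mul]; simp
  have hC : coeffC w Φ * formM w Φ Φ = conj (formM w Φ Φ) := by
    rw [coeffC, formM_conj, div_mul_cancel₀ _ hne]
  have hC' : conj (coeffC w Φ) * conj (formM w Φ Φ) = formM w Φ Φ := by
    rw [← map_mul, hC, Complex.conj_conj]
  have hD : coeffD w Φ * formM w Φ Φ = (w ^ 2 - conj w ^ 2) * Φ 0 * conj (Φ 1) := by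
    rw [coeffD, div_mul_cancel₀ _ hne]
  have hD' : conj (coeffD w Φ) * conj (formM w Φ Φ) =
      (conj w ^ 2 - w ^ 2) * conj (Φ 0) * Φ 1 := by
    rw [← map_mul, hD]; simp
  have hn : (‖w‖ : ℂ) ^ 2 = w * conj w := (Complex.mul_conj' w).symm
  rw [darbouxNumerator, hn]
  -- From here the roots, coefficients and forms are free variables tied by the relations collected
  -- above, and the claim is a polynomial identity.
  generalize coeffC w Φ ^ (1 / 2 : ℂ) = s at *
  generalize conj (coeffC w Φ) ^ (1 / 2 : ℂ) = t at *
  have hs : s = coeffC w Φ * t := by linear_combination t * hss - s * hst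
  have ht : t = conj (coeffC w Φ) * s := by linear_combination s * htt - t * hst
  have hm : formM w Φ Φ = w * Φ 0 * conj (Φ 0) + conj w * Φ 1 * conj (Φ 1) := rfl
  have hm' : conj (formM w Φ Φ) = conj w * Φ 0 * conj (Φ 0) + w * Φ 1 * conj (Φ 1) := by
    rw [← formM_conj, formM, Complex.conj_conj]
  generalize coeffC w Φ = C at *
  generalize coeffD w Φ = E at *
  generalize conj C = C' at *
  generalize conj E = E' at *
  generalize conj (formM w Φ Φ) = m' at *
  generalize formM w Φ Φ = m at *
  funext i
  fin_cases i
  · simp only [Matrix.mulVec, dotProduct, Fin.sum_univ_two, Fin.zero_eta, Matrix.of_apply,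
      Matrix.cons_val_zero, Matrix.cons_val_one, Pi.zero_apply]
    -- Multiplication by `m` clears the denominators of `C` and `D`; the second row uses `conj m` in
    -- the same way.
    refine (mul_eq_zero_iff_left hne).1 ?_
    rw [hs]
    linear_combination (t * w ^ 2 * Φ 0) * hC - (t * w * Φ 1) * hD + t * w ^ 2 * Φ 0 * hm' -
      w * conj w * t * Φ 0 * hm
  · simp only [Matrix.mulVec, dotProduct, Fin.sum_univ_two, Fin.mk_one, Matrix.of_apply,
      Matrix.cons_val_zero, Matrix.cons_val_one, Pi.zero_apply]
    refine (mul_eq_zero_iff_left hne').1 ?_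
    rw [ht]
    linear_combination (s * w ^ 2 * Φ 1) * hC' + (s * w * Φ 0) * hD' + s * w ^ 2 * Φ 1 * hm -
      w * conj w * s * Φ 1 * hm'

theorem darbouxNumerator_neg_mulVec (Φ v : Fin 2 → ℂ) (z w : ℂ) :
    (darbouxNumerator Φ (-z) w).mulVec (sigma3.mulVec v) =
      sigma3.mulVec ((darbouxNumerator Φ z w).mulVec v) := by
  funext i
  fin_cases i <;> simp [darbouxNumerator, sigma3, Matrix.mulVec, dotProduct, Fin.sum_univ_two]
  ring

/-! ### Removing the singularities -/

/-- A holomorphic function that vanishes at `±w` is divisible by `z² - w²`. -/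
theorem exists_eq_smul_of_eq_zero {E : Type*} [NormedAddCommGroup E] [NormedSpace ℂ E]
    [CompleteSpace E] {D : Set ℂ} (hD : IsOpen D) {G : ℂ → E} (hG : DifferentiableOn ℂ G D)
    {w : ℂ} (hw0 : w ≠ 0) (hw : w ∈ D) (hw' : -w ∈ D) (h : G w = 0) (h' : G (-w) = 0) :
    ∃ F : ℂ → E, DifferentiableOn ℂ F D ∧ ∀ z, G z = (z ^ 2 - w ^ 2) • F z := by
  set G₁ := dslope G w
  have e₁ : ∀ z, (z - w) • G₁ z = G z := fun z => by
    rw [sub_smul_dslope, h, sub_zero]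
  have hG₁ : DifferentiableOn ℂ G₁ D :=
    (Complex.differentiableOn_dslope (hD.mem_nhds hw)).2 hG
  -- The first quotient still vanishes at `-w`, because there the divisor equals `-2 * w ≠ 0`.
  have h₁ : G₁ (-w) = 0 := by
    have := e₁ (-w)
    rw [h'] at this
    refine (smul_eq_zero.1 this).resolve_left fun h0 => hw0 ?_
    linear_combination -(1 / 2 : ℂ) * h0
  refine ⟨dslope G₁ (-w), (Complex.differentiableOn_dslope (hD.mem_nhds hw')).2 hG₁, fun z => ?_⟩
  have e₂ : (z - -w) • dslope G₁ (-w) z = G₁ z := by rw [sub_smul_dslope, h₁, sub_zero]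
  rw [← e₁, ← e₂, smul_smul]
  ring_nf

/-- The Darboux transformation at `w` of a holomorphic solution family `u` has removable
singularities only. -/
theorem hasOnlyRemovableSingularities_darboux {D : Set ℂ} (hD : IsOpen D) {u : ℂ → Fin 2 → ℂ}
    (hu : DifferentiableOn ℂ u D) {w a ε : ℂ} (hwre : 0 < w.re) (hw : w ∈ D) (hw' : -w ∈ D)
    (ha : a ≠ 0) (hneg : u (-w) = ε • sigma3.mulVec (u w)) :
    HasOnlyRemovableSingularities (fun z => (darboux (a • u w) z w).mulVec (u z)) D {w, -w} := by
  set G : ℂ → Fin 2 → ℂ := fun z => (w ^ (1 / 2 : ℂ) / conj w ^ (1 / 2 : ℂ)) •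
    (darbouxNumerator (a • u w) z w).mulVec (u z) with hGdef
  have hw0 : w ≠ 0 := fun h => by simp [h] at hwre
  have hdar : ∀ z, (darboux (a • u w) z w).mulVec (u z) = (z ^ 2 - w ^ 2)⁻¹ • G z := fun z => by
    rw [darboux_eq_smul, Matrix.smul_mulVec, Matrix.smul_mulVec]
  have hzero : (darbouxNumerator (a • u w) w w).mulVec (u w) = 0 := by
    have := darbouxNumerator_mulVec_self hwre (a • u w)
    rw [Matrix.mulVec_smul] at this
    exact (smul_eq_zero.1 this).resolve_left ha
  have hG : DifferentiableOn ℂ G D := by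
    suffices DifferentiableOn ℂ (fun z => (darbouxNumerator (a • u w) z w).mulVec (u z)) D from
      this.const_smul (w ^ (1 / 2 : ℂ) / conj w ^ (1 / 2 : ℂ))
    refine differentiableOn_pi.2 fun i => ?_
    have hui := differentiableOn_pi.1 hu
    have h0 := hui 0
    have h1 := hui 1
    fin_cases i <;> simp only [darbouxNumerator, Matrix.mulVec, dotProduct, Fin.sum_univ_two,
      Fin.zero_eta, Fin.mk_one, Matrix.of_apply, Matrix.cons_val_zero, Matrix.cons_val_one] <;>
      fun_prop
  have hGw : G w = 0 := by simp only [hGdef, hzero, smul_zero]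
  -- The symmetry of `u` and of the numerator moves the evaluation at `-w` back to `w`.
  have hGw' : G (-w) = 0 := by
    simp only [hGdef, hneg, Matrix.mulVec_smul, darbouxNumerator_neg_mulVec, hzero,
      Matrix.mulVec_zero, smul_zero]
  obtain ⟨F, hF, hFG⟩ := exists_eq_smul_of_eq_zero hD hG hw0 hw hw' hGw hGw'
  have heq : EqOn F (fun z => (darboux (a • u w) z w).mulVec (u z)) (D \ {w, -w}) := by
    rintro z ⟨-, hz⟩
    have hne : z ^ 2 - w ^ 2 ≠ 0 := fun h0 => hz (sq_eq_sq_iff_eq_or_eq_neg.1 (sub_eq_zero.1 h0))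
    simp only [hdar, hFG, smul_smul, inv_mul_cancel₀ hne, one_smul]
  refine ⟨?_, (hF.mono sdiff_subset).congr fun z hz => (heq hz).symm, F, hF, heq⟩
  rintro z (rfl | rfl)
  exacts [hw, hw']

/-! ### Spectral regions and signs of the exponents -/

theorem isOpen_Dplus : IsOpen Dplus :=
  isOpen_lt continuous_const (by fun_prop)

theorem isOpen_Dminus : IsOpen Dminus :=
  isOpen_lt (by fun_prop) continuous_const

theorem neg_mem_Dplus {z : ℂ} (hz : z ∈ Dplus) : -z ∈ Dplus := by
  simpa [Dplus] using hz

theorem neg_mem_Dminus {z : ℂ} (hz : z ∈ Dminus) : -z ∈ Dminus := by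
  simpa [Dminus] using hz

theorem re_exponent (z : ℂ) (s : ℝ) (i j : Fin 2) :
    (-Complex.I * z ^ 2 * s * (sigma3 i i - sigma3 j j)).re =
      (z ^ 2).im * s * ((sigma3 i i).re - (sigma3 j j).re) := by
  fin_cases i <;> fin_cases j <;>
    simp [sigma3, Complex.mul_re, Complex.mul_im]

/-- Only `i = 1` contributes, with real part `-2 * (z ^ 2).im * s`. For the other column the sign
flips, so each Jost function has its own half of the spectral plane. -/
theorem re_exponent_nonpos_zero {z : ℂ} {s : ℝ} (h : 0 ≤ (z ^ 2).im * s) (i : Fin 2) :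
    (-Complex.I * z ^ 2 * s * (sigma3 i i - sigma3 0 0)).re ≤ 0 := by
  rw [re_exponent]
  fin_cases i
  · simp
  · simp [sigma3]; linarith

theorem re_exponent_nonpos_one {z : ℂ} {s : ℝ} (h : (z ^ 2).im * s ≤ 0) (i : Fin 2) :
    (-Complex.I * z ^ 2 * s * (sigma3 i i - sigma3 1 1)).re ≤ 0 := by
  rw [re_exponent]
  fin_cases i
  · simp [sigma3]; linarith
  · simp

end DNLSII

end

/-! ### The four Jost functions -/

theorem proposition4p1 (q : ℝ → ℂ) (hq₂ : DNLSII.MemSobolev 2 q)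
    (hq₁ : DNLSII.MemWeightedSobolev 1 1 q) (lam₁ : ℂ) (hlam₁ : lam₁ ∈ DNLSII.firstQuadrant) :
    ((∀ z ∈ DNLSII.Dplus,
        (∃! u, DNLSII.IsJostMinus q z 0 u) ∧ (∃! u, DNLSII.IsJostPlus q z 1 u)) ∧
      (∀ z ∈ DNLSII.Dminus,
        (∃! u, DNLSII.IsJostPlus q z 0 u) ∧ (∃! u, DNLSII.IsJostMinus q z 1 u))) ∧
    ∀ x : ℝ,
      DNLSII.HasOnlyRemovableSingularities (DNLSII.newVarphiMinus q lam₁ x)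
        DNLSII.Dplus {lam₁, -lam₁} ∧
      DNLSII.HasOnlyRemovableSingularities (DNLSII.newPhiPlus q lam₁ x)
        DNLSII.Dplus {lam₁, -lam₁} ∧
      DNLSII.HasOnlyRemovableSingularities (DNLSII.newVarphiPlus q lam₁ x)
        DNLSII.Dminus {(starRingEnd ℂ) lam₁, -(starRingEnd ℂ) lam₁} ∧
      DNLSII.HasOnlyRemovableSingularities (DNLSII.newPhiMinus q lam₁ x)
        DNLSII.Dminus {(starRingEnd ℂ) lam₁, -(starRingEnd ℂ) lam₁} := by
  open DNLSII Set in
  have hq := hq₁.integrable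
  have hq2 := hq₁.integrable_norm_sq
  obtain ⟨hre, him⟩ := hlam₁
  have hmem : lam₁ ∈ Dplus := by
    simp only [Dplus, mem_ofPred_eq, sq, Complex.mul_im]
    nlinarith [mul_pos hre him]
  have hmem' : conj lam₁ ∈ Dminus := by
    simp only [Dminus, mem_ofPred_eq, sq, Complex.mul_im, Complex.conj_re, Complex.conj_im]
    nlinarith [mul_pos hre him]
  -- Conjugation moves the point to `D₋` but keeps its real part positive, so the same Darboux lemma
  -- serves all four functions.
  have hre' : 0 < (conj lam₁).re := by rwa [Complex.conj_re]
  have sVm : ∀ z ∈ Dplus, ∀ x, ∀ y ∈ Iic x, ∀ i,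
      (-Complex.I * z ^ 2 * (x - y : ℝ) * (sigma3 i i - sigma3 0 0)).re ≤ 0 := fun z hz x y hy =>
    re_exponent_nonpos_zero (mul_nonneg (le_of_lt hz) (sub_nonneg.2 hy))
  have sPp : ∀ z ∈ Dplus, ∀ x, ∀ y ∈ Ioi x, ∀ i,
      (-Complex.I * z ^ 2 * (x - y : ℝ) * (sigma3 i i - sigma3 1 1)).re ≤ 0 := fun z hz x y hy =>
    re_exponent_nonpos_one (mul_nonpos_of_nonneg_of_nonpos (le_of_lt hz)
      (sub_nonpos.2 (le_of_lt hy)))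
  have sVp : ∀ z ∈ Dminus, ∀ x, ∀ y ∈ Ioi x, ∀ i,
      (-Complex.I * z ^ 2 * (x - y : ℝ) * (sigma3 i i - sigma3 0 0)).re ≤ 0 := fun z hz x y hy =>
    re_exponent_nonpos_zero (mul_nonneg_of_nonpos_of_nonpos (le_of_lt hz)
      (sub_nonpos.2 (le_of_lt hy)))
  have sPm : ∀ z ∈ Dminus, ∀ x, ∀ y ∈ Iic x, ∀ i,
      (-Complex.I * z ^ 2 * (x - y : ℝ) * (sigma3 i i - sigma3 1 1)).re ≤ 0 := fun z hz x y hy =>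
    re_exponent_nonpos_one (mul_nonpos_of_nonpos_of_nonneg (le_of_lt hz) (sub_nonneg.2 hy))
  have hI := isVolterraDomain_Iic
  have hJ := isVolterraDomain_Ioi
  have h1 : ‖(1 : ℂ)‖ = 1 := norm_one
  have h1' : ‖(-1 : ℂ)‖ = 1 := by simp
  have hP := isOpen_Dplus
  have hM := isOpen_Dminus
  refine ⟨⟨fun z hz => ⟨?_, ?_⟩, fun z hz => ⟨?_, ?_⟩⟩, fun x => ⟨?_, ?_, ?_, ?_⟩⟩
  · rw [isJostMinus_eq]
    exact existsUnique_isJostSolution hI h1 hq hq2 hP sVm hz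
  · rw [isJostPlus_eq]
    exact existsUnique_isJostSolution hJ h1' hq hq2 hP sPp hz
  · rw [isJostPlus_eq]
    exact existsUnique_isJostSolution hJ h1' hq hq2 hM sVp hz
  · rw [isJostMinus_eq]
    exact existsUnique_isJostSolution hI h1 hq hq2 hM sPm hz
  · refine hasOnlyRemovableSingularities_darboux (u := varphiMinus q x) (ε := sigma3 0 0) hP ?_ hre
      hmem (neg_mem_Dplus hmem) (Complex.exp_ne_zero _) ?_
    · change DifferentiableOn ℂ (fun z => Classical.epsilon (IsJostMinus q z 0) x) _
      simp only [isJostMinus_eq]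
      exact differentiableOn_jostSolution hI h1 hq hq2 hP sVm x
    · simp only [varphiMinus, isJostMinus_eq]
      exact jostSolution_neg hI h1 hq hq2 hP sVm hmem (neg_mem_Dplus hmem) x
  · refine hasOnlyRemovableSingularities_darboux (u := phiPlus q x) (ε := sigma3 1 1) hP ?_ hre
      hmem (neg_mem_Dplus hmem) (Complex.exp_ne_zero _) ?_
    · change DifferentiableOn ℂ (fun z => Classical.epsilon (IsJostPlus q z 1) x) _
      simp only [isJostPlus_eq]
      exact differentiableOn_jostSolution hJ h1' hq hq2 hP sPp x
    · simp only [phiPlus, isJostPlus_eq]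
      exact jostSolution_neg hJ h1' hq hq2 hP sPp hmem (neg_mem_Dplus hmem) x
  · refine hasOnlyRemovableSingularities_darboux (u := varphiPlus q x) (ε := sigma3 0 0) hM ?_ hre'
      hmem' (neg_mem_Dminus hmem') (Complex.exp_ne_zero _) ?_
    · change DifferentiableOn ℂ (fun z => Classical.epsilon (IsJostPlus q z 0) x) _
      simp only [isJostPlus_eq]
      exact differentiableOn_jostSolution hJ h1' hq hq2 hM sVp x
    · simp only [varphiPlus, isJostPlus_eq]
      exact jostSolution_neg hJ h1' hq hq2 hM sVp hmem' (neg_mem_Dminus hmem') x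
  · refine hasOnlyRemovableSingularities_darboux (u := phiMinus q x) (ε := sigma3 1 1) hM ?_ hre'
      hmem' (neg_mem_Dminus hmem') (Complex.exp_ne_zero _) ?_
    · change DifferentiableOn ℂ (fun z => Classical.epsilon (IsJostMinus q z 1) x) _
      simp only [isJostMinus_eq]
      exact differentiableOn_jostSolution hI h1 hq hq2 hM sPm x
    · simp only [phiMinus, isJostMinus_eq]
      exact jostSolution_neg hI h1 hq hq2 hM sPm hmem' (neg_mem_Dminus hmem') x
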